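/- Let $d\ge 2$ and let $G=\mathrm{SL}(d,\mathbb R)$. Let $\mathfrak a=\{Y\in\mathbb R^d:\sum_i Y_i=0\}$, regarded as the space of trace-zero diagonal matrices, $A=\exp(\mathfrak a)$, $K=\mathrm{SO}(d)$, and $M=Z_K(A)$ (the diagonal matrices of determinant $1$ with entries $\pm1$). Let $\mathfrak a^{+}=\{Y\in\mathfrak a: Y_1\ge\dots\ge Y_d\}$ and $\mathfrak a^{++}=\{Y\in\mathfrak a: Y_1>\dots>Y_d\}$. The Jordan projection $\lambda(g)\in\mathfrak a^+$ of $g\in G$ is the unique element such that the hyperbolic part of $g$ in its Jordan decomposition $g=g_eg_hg_u$ is conjugate to $\exp(\lambda(g))$; $g$ is loxodromic if $\lambda(g)\in\mathfrak a^{++}$. Let $\Gamma$ be a finite index subgroup of $\mathrm{SL}(d,\mathbb Z)$ and let $\gamma\in\Gamma$ be loxodromic. Choose $g_\gamma\in G$ with $g_\gamma^{-1}\gamma g_\gamma\in\exp(\lambda(\gamma))M$, and let $F_{[\gamma]}=\Gamma g_\gamma AM\subset\Gamma\backslash G/M$, which is a right $A$-orbit that does not depend on the choice of $g_\gamma$.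 A right $A$-orbit $F\subset\Gamma\backslash G/M$ is called compact periodic if its set of periods $\Lambda(F)=\{Y\in\mathfrak a: ze^Y=z \text{ for all } z\in F\}$ is a lattice in $\mathfrak a$. Consider the conditions: (1) the $A$-orbit $F_{[\gamma]}$ is compact periodic; (1$'$) $F_{[\gamma]}$ is a compact subset of $\Gamma\backslash G/M$ (with the quotient topology); (2) the characteristic polynomial $p_\gamma(x)=\det(x-\gamma)$ of $\gamma$ is irreducible in $\mathbb Q[x]$; (3) there is no subset $I$ with $\emptyset\ne I\subsetneq\{1,\dots,d\}$ and $\sum_{i\in I}t_i=0$, where $(t_1,\dots,t_d)=\lambda(\gamma)$. Then (1), (1$'$) and (2) are equivalent, and (3) implies (2). -/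

import Mathlib

noncomputable section

namespace PeriodicTori

/-- The Lie group `G = SL(d, ℝ)` (with its topology as a subspace of the space of matrices). -/
abbrev G (d : ℕ) : Type := Matrix.SpecialLinearGroup (Fin d) ℝ

/-- The Cartan subspace `𝔞` of diagonal matrices of trace zero; such a matrix is recorded by its
diagonal entries. -/
abbrev cartan (d : ℕ) : Submodule ℝ (Fin d → ℝ) :=
  LinearMap.ker (∑ i, LinearMap.proj i : (Fin d → ℝ) →ₗ[ℝ] ℝ)

lemma mem_cartan {d : ℕ} {Y : Fin d → ℝ} : Y ∈ cartan d ↔ ∑ i, Y i = 0 := by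
  simp [cartan, LinearMap.mem_ker]

/-- The exponential map `exp : 𝔞 → G`, `Y ↦ diag(e^{Y₁}, …, e^{Y_d})`. -/
def expA {d : ℕ} (Y : cartan d) : G d :=
  ⟨Matrix.diagonal fun i => Real.exp ((Y : Fin d → ℝ) i), by
    rw [Matrix.det_diagonal, ← Real.exp_sum, mem_cartan.1 Y.2, Real.exp_zero]⟩

lemma expA_add {d : ℕ} (Y Z : cartan d) : expA (Y + Z) = expA Y * expA Z := by
  apply Subtype.ext
  rw [Matrix.SpecialLinearGroup.coe_mul]
  simp [expA, Matrix.diagonal_mul_diagonal, Real.exp_add]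

lemma expA_zero {d : ℕ} : expA (0 : cartan d) = 1 := by
  apply Subtype.ext
  simp [expA]

lemma expA_neg {d : ℕ} (Y : cartan d) : expA (-Y) = (expA Y)⁻¹ := by
  rw [eq_inv_iff_mul_eq_one, ← expA_add, neg_add_cancel, expA_zero]

/-- The group `A = exp 𝔞` of positive diagonal matrices of determinant one. -/
def A (d : ℕ) : Subgroup (G d) where
  carrier := Set.range expA
  mul_mem' := by
    rintro _ _ ⟨Y, rfl⟩ ⟨Z, rfl⟩
    exact ⟨Y + Z, expA_add Y Z⟩
  one_mem' := ⟨0, expA_zero⟩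
  inv_mem' := by
    rintro _ ⟨Y, rfl⟩
    exact ⟨-Y, expA_neg Y⟩

/-- The maximal compact subgroup `K = SO(d)`. -/
def K (d : ℕ) : Subgroup (G d) where
  carrier := {k | (k : Matrix (Fin d) (Fin d) ℝ) ∈ Matrix.orthogonalGroup (Fin d) ℝ}
  mul_mem' := by
    intro a b ha hb
    simpa using mul_mem ha hb
  one_mem' := by
    simp
  inv_mem' := by
    intro a ha
    have h1 : (a : Matrix (Fin d) (Fin d) ℝ) * star (a : Matrix (Fin d) (Fin d) ℝ) = 1 :=
      (Matrix.mem_orthogonalGroup_iff (Fin d) ℝ).1 ha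
    have h2 : ((a⁻¹ : G d) : Matrix (Fin d) (Fin d) ℝ) * (a : Matrix (Fin d) (Fin d) ℝ) = 1 := by
      rw [← Matrix.SpecialLinearGroup.coe_mul, inv_mul_cancel, Matrix.SpecialLinearGroup.coe_one]
    have h3 : ((a⁻¹ : G d) : Matrix (Fin d) (Fin d) ℝ) = star (a : Matrix (Fin d) (Fin d) ℝ) :=
      left_inv_eq_right_inv h2 h1
    change ((a⁻¹ : G d) : Matrix (Fin d) (Fin d) ℝ) ∈ Matrix.orthogonalGroup (Fin d) ℝ
    rw [h3]
    exact Unitary.star_mem ha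

/-- The group `M = Z_K(A)`, the centralizer of `A` in `K`. -/
def M (d : ℕ) : Subgroup (G d) :=
  K d ⊓ Subgroup.centralizer (A d : Set (G d))

/-- `g ∈ N`: upper triangular with all diagonal entries equal to `1`. -/
def IsUpperUnipotent {d : ℕ} (g : G d) : Prop :=
  (∀ i j : Fin d, j < i → (g : Matrix (Fin d) (Fin d) ℝ) i j = 0) ∧
    ∀ i : Fin d, (g : Matrix (Fin d) (Fin d) ℝ) i i = 1

/-- The open positive Weyl chamber `𝔞⁺⁺ = {Y₁ > ⋯ > Y_d}`. -/
def openChamber (d : ℕ) : Set (cartan d) := {Y | StrictAnti (Y : Fin d → ℝ)}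

/-- The closed positive Weyl chamber `𝔞⁺ = {Y₁ ≥ ⋯ ≥ Y_d}`. -/
def closedChamber (d : ℕ) : Set (cartan d) := {Y | Antitone (Y : Fin d → ℝ)}

/-- `g = g_e g_h g_u` is a Jordan decomposition of `g`: the three factors commute and are conjugate
in `G` to an element of `K`, of `A⁺ = exp 𝔞⁺` and of `N` respectively. -/
structure IsJordanDecomposition {d : ℕ} (g ge gh gu : G d) : Prop where
  eq_mul : g = ge * gh * gu
  commute_eh : Commute ge gh
  commute_eu : Commute ge gu
  commute_hu : Commute gh gu
  elliptic : ∃ k ∈ K d, IsConj ge k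
  hyperbolic : ∃ Y ∈ closedChamber d, IsConj gh (expA Y)
  unipotent : ∃ n : G d, IsUpperUnipotent n ∧ IsConj gu n

/-- `Y ∈ 𝔞⁺` and the hyperbolic part of `g` is conjugate to `exp Y`. -/
def IsJordanProjection {d : ℕ} (g : G d) (Y : cartan d) : Prop :=
  Y ∈ closedChamber d ∧
    ∃ ge gh gu : G d, IsJordanDecomposition g ge gh gu ∧ IsConj gh (expA Y)

open Classical in
/-- The Jordan projection `λ : G → 𝔞⁺`. (Every `g` has exactly one `Y` with
`IsJordanProjection g Y`; the second branch does not occur.) -/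
def jordanProjection {d : ℕ} (g : G d) : cartan d :=
  if h : ∃ Y, IsJordanProjection g Y then h.choose else 0

/-- `g` is loxodromic: its Jordan projection lies in the open chamber. -/
def IsLoxodromic {d : ℕ} (g : G d) : Prop := jordanProjection g ∈ openChamber d

/-- The inclusion `SL(d, ℤ) → SL(d, ℝ)`. -/
abbrev toReal {d : ℕ} : Matrix.SpecialLinearGroup (Fin d) ℤ →* G d :=
  Matrix.SpecialLinearGroup.map (Int.castRingHom ℝ)

/-- The space `Γ \ G / M`, for a subgroup `Γ` of `SL(d, ℤ)`. -/
def Space {d : ℕ} (Γ : Subgroup (Matrix.SpecialLinearGroup (Fin d) ℤ)) : Type :=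
  DoubleCoset.Quotient ((Γ.map toReal : Subgroup (G d)) : Set (G d)) (M d : Set (G d))

variable {d : ℕ} {Γ : Subgroup (Matrix.SpecialLinearGroup (Fin d) ℤ)}

/-- The projection `π : G → Γ \ G / M`. -/
def proj (Γ : Subgroup (Matrix.SpecialLinearGroup (Fin d) ℤ)) (g : G d) : Space Γ :=
  DoubleCoset.mk (Γ.map toReal) (M d) g

/-- The quotient topology on `Γ \ G / M`. -/
instance : TopologicalSpace (Space Γ) :=
  TopologicalSpace.coinduced (proj Γ) inferInstance

lemma proj_eq_iff (g h : G d) :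
    proj Γ g = proj Γ h ↔ ∃ γ ∈ Γ, ∃ m ∈ M d, h = toReal γ * g * m := by
  refine (DoubleCoset.eq (Γ.map toReal) (M d) g h).trans ?_
  simp only [Subgroup.mem_map, exists_exists_and_eq_and]

/-- The right action of `A = exp 𝔞` on `Γ \ G / M`: `(Γ g M) · e^Y = Γ g e^Y M`. -/
def act (z : Space Γ) (Y : cartan d) : Space Γ :=
  Quotient.liftOn z (fun g => proj Γ (g * expA Y)) (by
    intro g h hgh
    obtain ⟨γ, hγ, m, hm, rfl⟩ := (proj_eq_iff g h).1 (Quotient.sound hgh)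
    refine (proj_eq_iff _ _).2 ⟨γ, hγ, m, hm, ?_⟩
    have hc : expA Y * m = m * expA Y := (Subgroup.mem_inf.1 hm).2 _ ⟨Y, rfl⟩
    simp only [mul_assoc, hc])

lemma act_proj (g : G d) (Y : cartan d) : act (proj Γ g) Y = proj Γ (g * expA Y) := rfl

lemma proj_surjective : Function.Surjective (proj Γ) := by
  intro z
  induction z using Quotient.inductionOn with
  | h g => exact ⟨g, rfl⟩

lemma act_add (z : Space Γ) (Y Z : cartan d) : act z (Y + Z) = act (act z Y) Z := by
  obtain ⟨g, rfl⟩ := proj_surjective z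
  simp only [act_proj, expA_add, mul_assoc]

lemma act_zero (z : Space Γ) : act z 0 = z := by
  obtain ⟨g, rfl⟩ := proj_surjective z
  rw [act_proj, expA_zero, mul_one]

/-- The right `A`-orbit of a point of `Γ \ G / M`. -/
def orbitA (z : Space Γ) : Set (Space Γ) := Set.range (act z)

/-- The set of periods `Λ(F) = {Y ∈ 𝔞 | z e^Y = z for all z ∈ F}`, a subgroup of `𝔞`. -/
def periods (F : Set (Space Γ)) : AddSubgroup (cartan d) where
  carrier := {Y | ∀ z ∈ F, act z Y = z}
  add_mem' := by
    intro Y Z hY hZ z hz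
    rw [act_add, hY z hz, hZ z hz]
  zero_mem' := fun z _ => act_zero z
  neg_mem' := by
    intro Y hY z hz
    nth_rewrite 1 [← hY z hz]
    rw [← act_add, add_neg_cancel, act_zero]

/-- `F` is a compact periodic `A`-orbit (a maximal flat periodic torus): it is an `A`-orbit, and
its periods form a lattice of `𝔞`, that is, a discrete subgroup spanning `𝔞` over `ℝ`. -/
def IsCompactPeriodic (F : Set (Space Γ)) : Prop :=
  (∃ z, F = orbitA z) ∧ DiscreteTopology (periods F) ∧
    Submodule.span ℝ (periods F : Set (cartan d)) = ⊤

/-- The elements `g_γ` of `G` with `g_γ⁻¹ γ g_γ ∈ exp(λ(γ)) M`. For loxodromic `γ` they form one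
coset of `AM`, consisting of the `g` that send the standard pair of opposite points of the
Furstenberg boundary to the attracting and repelling fixed points of `γ`. -/
def frames (γ : Matrix.SpecialLinearGroup (Fin d) ℤ) : Set (G d) :=
  {g | ∃ m ∈ M d, g⁻¹ * toReal γ * g = expA (jordanProjection (toReal γ)) * m}

/-- The `A`-orbit `F_[γ] = Γ g_γ A M` in `Γ \ G / M`, where `g_γ⁻¹ γ g_γ ∈ exp(λ(γ)) M`. It does
not depend on `g_γ`, so the union over all of these is taken. -/
def flatOrbit (Γ : Subgroup (Matrix.SpecialLinearGroup (Fin d) ℤ))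
    (γ : Matrix.SpecialLinearGroup (Fin d) ℤ) : Set (Space Γ) :=
  ⋃ g ∈ frames γ, orbitA (proj Γ g)

end PeriodicTori

end

noncomputable section

namespace PeriodicTori

open scoped Matrix

variable {d : ℕ} {Γ : Subgroup (Matrix.SpecialLinearGroup (Fin d) ℤ)}

/-! A loxodromic `γ` has real eigenvalues `μ i` with `|μ i| = exp (λ(γ) i)`, of pairwise distinct
moduli, and `γ g = g · diag μ` for a frame `g` whose `A`-orbit in `Γ \ G / M` is the flat orbit. The
proof runs the cycle compact periodic, compact, irreducible, compact periodic.

Periods always form a discrete group, so a compact periodic orbit is the continuous image of a torus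
(`IsCompactPeriodic.isCompact`).

If the characteristic polynomial had a proper integral factor `f`, an integral row vector `w ≠ 0`
would satisfy `w f(γ) = 0`. Then `w g` is supported on the eigenvalues that are roots of `f`, and a
suitable `e^Y` contracts it below any bound, which Mahler's criterion forbids on a compact orbit
(`irreducible_of_isCompact`).

If the polynomial is irreducible, `ℚ[x]/(p_γ)` is a totally real field. Powers of its units are
integral polynomials in `γ` lying in `Γ`, and Dirichlet's unit theorem makes the resulting periods
span `𝔞` (`span_periods_eq_top_of_irreducible`).

For the partial sums: a monic integral factor has constant term `±1`, so the `λ(γ) i` belonging to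
its roots sum to zero (`irreducible_of_no_zero_sum`). -/

lemma expA_coe (Y : cartan d) :
    (expA Y : Matrix (Fin d) (Fin d) ℝ) =
      Matrix.diagonal fun i => Real.exp ((Y : Fin d → ℝ) i) := rfl

/-! ### Diagonal matrices, the group `M`, and frames of loxodromic elements -/

/-- A matrix intertwining two diagonal matrices whose entries are distinct off the diagonal is
diagonal. -/
lemma eq_diagonal_of_intertwine {R : Type*} [CommRing R] [IsDomain R]
    {B : Matrix (Fin d) (Fin d) R} {s t : Fin d → R}
    (hst : ∀ i j, s i = t j → i = j)
    (h : Matrix.diagonal s * B = B * Matrix.diagonal t) :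
    B = Matrix.diagonal fun i => B i i := by
  ext i j
  have h1 := congrFun (congrFun h i) j
  rw [Matrix.diagonal_mul, Matrix.mul_diagonal] at h1
  rcases eq_or_ne i j with rfl | hij
  · simp
  · rw [Matrix.diagonal_apply_ne _ hij]
    have h2 : (s i - t j) * B i j = 0 := by linear_combination h1
    rcases mul_eq_zero.1 h2 with h3 | h3
    · exact absurd (hst i j (sub_eq_zero.1 h3)) hij
    · exact h3

lemma exp_openChamber_injective {Y : cartan d} (hY : Y ∈ openChamber d) (i j : Fin d)
    (h : Real.exp ((Y : Fin d → ℝ) i) = Real.exp ((Y : Fin d → ℝ) j)) : i = j :=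
  StrictAnti.injective hY (Real.exp_injective h)

lemma eq_diagonal_of_commute {Y : cartan d} (hY : Y ∈ openChamber d) {B : G d}
    (h : Commute B (expA Y)) :
    (B : Matrix (Fin d) (Fin d) ℝ) =
      Matrix.diagonal fun i => (B : Matrix (Fin d) (Fin d) ℝ) i i := by
  refine eq_diagonal_of_intertwine (exp_openChamber_injective hY) ?_
  have h1 := congrArg (fun x : G d => (x : Matrix (Fin d) (Fin d) ℝ)) h.eq
  simpa [expA_coe] using h1.symm

lemma mem_K_of_diagonal {ε : Fin d → ℝ} (hε : ∀ i, |ε i| = 1) {m : G d}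
    (hm : (m : Matrix (Fin d) (Fin d) ℝ) = Matrix.diagonal ε) : m ∈ K d := by
  change (m : Matrix (Fin d) (Fin d) ℝ) ∈ Matrix.orthogonalGroup (Fin d) ℝ
  rw [Matrix.mem_orthogonalGroup_iff, hm, Matrix.diagonal_transpose,
    Matrix.diagonal_mul_diagonal, ← Matrix.diagonal_one]
  congr 1
  ext i
  have : ε i * ε i = 1 := by rw [← abs_mul_abs_self, hε i, one_mul]
  simpa using this

lemma mem_M_of_diagonal {ε : Fin d → ℝ} (hε : ∀ i, |ε i| = 1) {m : G d}
    (hm : (m : Matrix (Fin d) (Fin d) ℝ) = Matrix.diagonal ε) : m ∈ M d := by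
  refine Subgroup.mem_inf.2 ⟨mem_K_of_diagonal hε hm, ?_⟩
  rw [Subgroup.mem_centralizer_iff]
  rintro _ ⟨Y, rfl⟩
  apply Subtype.ext
  simp only [Matrix.SpecialLinearGroup.coe_mul, hm, expA_coe, Matrix.diagonal_mul_diagonal,
    mul_comm]

/-- A real eigenvalue of an element of `SO(d)` has absolute value one. -/
lemma abs_eigenvalue_of_mem_K {k : G d} (hk : k ∈ K d) {v : Fin d → ℝ} (hv : v ≠ 0) {c : ℝ}
    (h : (k : Matrix (Fin d) (Fin d) ℝ).mulVec v = c • v) : |c| = 1 := by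
  have h1 : star (k : Matrix (Fin d) (Fin d) ℝ) * (k : Matrix (Fin d) (Fin d) ℝ) = 1 :=
    (Matrix.mem_orthogonalGroup_iff' (Fin d) ℝ).1 hk
  have h2 : (c • v) ⬝ᵥ (c • v) = v ⬝ᵥ v := by
    rw [← h, Matrix.dotProduct_mulVec, Matrix.vecMul_mulVec]
    rw [Matrix.star_eq_conjTranspose, Matrix.conjTranspose_eq_transpose_of_trivial] at h1
    rw [← Matrix.dotProduct_mulVec, h1, Matrix.one_mulVec]
  have h3 : v ⬝ᵥ v ≠ 0 := fun h0 => hv (dotProduct_self_eq_zero.1 h0)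
  rw [smul_dotProduct, dotProduct_smul, smul_eq_mul, smul_eq_mul, ← mul_assoc] at h2
  have h4 : c * c = 1 := mul_right_cancel₀ h3 (by rw [h2, one_mul])
  rcases mul_self_eq_one_iff.1 h4 with rfl | rfl <;> simp

/-- The conjugating matrix carries the `i`-th basis vector to a real eigenvector of `k` with
eigenvalue `e i`. -/
lemma abs_diagonal_of_isConj_mem_K {E k : G d} {e : Fin d → ℝ}
    (hE : (E : Matrix (Fin d) (Fin d) ℝ) = Matrix.diagonal e) (hk : k ∈ K d) (h : IsConj E k)
    (i : Fin d) : |e i| = 1 := by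
  obtain ⟨c, hc⟩ := isConj_iff.1 h
  have h1 : k * c = c * E := by rw [← hc]; group
  have h2 := congrArg (fun x : G d => (x : Matrix (Fin d) (Fin d) ℝ)) h1
  simp only [Matrix.SpecialLinearGroup.coe_mul, hE] at h2
  refine abs_eigenvalue_of_mem_K hk (v := (c : Matrix (Fin d) (Fin d) ℝ).mulVec (Pi.single i 1))
    ?_ ?_
  · intro h0
    have h3 := congrArg ((c⁻¹ : G d) : Matrix (Fin d) (Fin d) ℝ).mulVec h0
    rw [Matrix.mulVec_mulVec, ← Matrix.SpecialLinearGroup.coe_mul, inv_mul_cancel,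
      Matrix.SpecialLinearGroup.coe_one, Matrix.one_mulVec, Matrix.mulVec_zero] at h3
    simpa using congrFun h3 i
  · rw [Matrix.mulVec_mulVec, h2, ← Matrix.mulVec_mulVec, ← Matrix.mulVec_smul]
    congr 1
    ext j
    rw [Matrix.mulVec_diagonal]
    rcases eq_or_ne j i with rfl | hj
    · simp
    · simp [hj]

lemma charpoly_eq_of_isConj {a b : G d} (h : IsConj a b) :
    (a : Matrix (Fin d) (Fin d) ℝ).charpoly = (b : Matrix (Fin d) (Fin d) ℝ).charpoly := by
  obtain ⟨c, rfl⟩ := isConj_iff.1 h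
  rw [Matrix.SpecialLinearGroup.coe_mul, Matrix.charpoly_mul_comm,
    ← Matrix.SpecialLinearGroup.coe_mul, inv_mul_cancel_left]

/-- The entries of `u` are roots of the characteristic polynomial of `n`, which is `(X - 1)^d`. -/
lemma eq_one_of_isConj_unipotent {U n : G d} {u : Fin d → ℝ}
    (hU : (U : Matrix (Fin d) (Fin d) ℝ) = Matrix.diagonal u) (hn : IsUpperUnipotent n)
    (h : IsConj U n) : U = 1 := by
  have h1 := charpoly_eq_of_isConj h
  rw [hU, Matrix.charpoly_diagonal, Matrix.charpoly_of_isUpperTriangular _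
    (fun i j hij => hn.1 i j hij)] at h1
  apply Subtype.ext
  rw [hU, Matrix.SpecialLinearGroup.coe_one, ← Matrix.diagonal_one]
  congr 1
  ext i
  have h2 := congrArg (Polynomial.eval (u i)) h1
  rw [Polynomial.eval_prod, Polynomial.eval_prod, Finset.prod_eq_zero (Finset.mem_univ i) (by simp)]
    at h2
  obtain ⟨j, -, hj⟩ := Finset.prod_eq_zero_iff.1 h2.symm
  rw [hn.2 j] at hj
  simpa [sub_eq_zero] using hj

lemma isJordanProjection_of_isLoxodromic (hd : 2 ≤ d) {g : G d} (h : IsLoxodromic g) :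
    IsJordanProjection g (jordanProjection g) := by
  classical
  unfold IsLoxodromic at h
  by_cases hex : ∃ Y, IsJordanProjection g Y
  · rw [jordanProjection, dif_pos hex]
    exact hex.choose_spec
  -- The default value `0` is not strictly decreasing once there are two coordinates.
  · rw [jordanProjection, dif_neg hex] at h
    have h1 := StrictAnti.injective (show StrictAnti ((0 : cartan d) : Fin d → ℝ) from h)
      (a₁ := ⟨0, by omega⟩) (a₂ := ⟨1, by omega⟩) rfl
    simp at h1

/-- A loxodromic element is conjugate into `exp(𝔞⁺⁺) M`. -/
lemma exists_conj_eq_expA_mul (hd : 2 ≤ d) {g : G d} (h : IsLoxodromic g) :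
    ∃ c : G d, ∃ m ∈ M d, c⁻¹ * g * c = expA (jordanProjection g) * m := by
  obtain ⟨-, ge, gh, gu, hJ, hconj⟩ := isJordanProjection_of_isLoxodromic hd h
  set Y := jordanProjection g with hY
  obtain ⟨b, hb⟩ := isConj_iff.1 hconj
  have hcomm : ∀ x : G d, Commute x gh → Commute (b * x * b⁻¹) (expA Y) := by
    intro x hx
    rw [← hb]
    change b * x * b⁻¹ * (b * gh * b⁻¹) = b * gh * b⁻¹ * (b * x * b⁻¹)
    have : b * x * b⁻¹ * (b * gh * b⁻¹) = b * (x * gh) * b⁻¹ := by group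
    rw [this, hx.eq]
    group
  -- After conjugation by `b`, the elliptic and unipotent parts commute with the regular element
  -- `expA Y` and so are diagonal. The unipotent part is then trivial and the elliptic one has
  -- entries `±1`.
  have hE := eq_diagonal_of_commute h (hcomm ge hJ.commute_eh)
  have hU := eq_diagonal_of_commute h (hcomm gu hJ.commute_hu.symm)
  obtain ⟨k, hk, hek⟩ := hJ.elliptic
  obtain ⟨n, hn, hun⟩ := hJ.unipotent
  have hcE : IsConj ge (b * ge * b⁻¹) := isConj_iff.2 ⟨b, rfl⟩
  have hcU : IsConj gu (b * gu * b⁻¹) := isConj_iff.2 ⟨b, rfl⟩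
  have hU1 := eq_one_of_isConj_unipotent hU hn (hcU.symm.trans hun)
  have hgu : gu = 1 := by
    have : gu = b⁻¹ * (b * gu * b⁻¹) * b := by group
    rw [this, hU1]; group
  refine ⟨b⁻¹, b * ge * b⁻¹,
    mem_M_of_diagonal (abs_diagonal_of_isConj_mem_K hE hk (hcE.symm.trans hek)) hE, ?_⟩
  rw [← (hcomm ge hJ.commute_eh).eq, ← hb, hJ.eq_mul, hgu]
  group

lemma frames_nonempty (hd : 2 ≤ d) {γ : Matrix.SpecialLinearGroup (Fin d) ℤ}
    (h : IsLoxodromic (toReal γ)) : (frames γ).Nonempty :=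
  exists_conj_eq_expA_mul hd h

/-- `Y` only supplies one regular element of `A`, whose centralizer is already diagonal. -/
lemma exists_diagonal_of_mem_M {Y : cartan d} (hY : Y ∈ openChamber d) {m : G d} (hm : m ∈ M d) :
    ∃ ε : Fin d → ℝ, (∀ i, |ε i| = 1) ∧
      (m : Matrix (Fin d) (Fin d) ℝ) = Matrix.diagonal ε := by
  obtain ⟨hk, hc⟩ := Subgroup.mem_inf.1 hm
  have hdiag := eq_diagonal_of_commute hY (B := m)
    ((Subgroup.mem_centralizer_iff.1 hc) _ ⟨Y, rfl⟩).symm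
  exact ⟨_, abs_diagonal_of_isConj_mem_K hdiag hk (IsConj.refl m), hdiag⟩

/-- The eigenvalues of a loxodromic element, in a frame of eigenvectors. -/
lemma exists_eigenvalues_of_mem_frames {γ : Matrix.SpecialLinearGroup (Fin d) ℤ}
    (h : IsLoxodromic (toReal γ)) {g : G d} (hg : g ∈ frames γ) :
    ∃ μ : Fin d → ℝ,
      (∀ i, |μ i| = Real.exp ((jordanProjection (toReal γ) : Fin d → ℝ) i)) ∧
      (toReal γ : Matrix (Fin d) (Fin d) ℝ) * (g : Matrix (Fin d) (Fin d) ℝ) =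
        (g : Matrix (Fin d) (Fin d) ℝ) * Matrix.diagonal μ := by
  obtain ⟨m, hm, hgm⟩ := hg
  obtain ⟨ε, hε, hmε⟩ := exists_diagonal_of_mem_M h hm
  refine ⟨fun i => Real.exp ((jordanProjection (toReal γ) : Fin d → ℝ) i) * ε i, ?_, ?_⟩
  · intro i
    rw [abs_mul, hε i, mul_one, Real.abs_exp]
  · have h1 : toReal γ * g = g * (expA (jordanProjection (toReal γ)) * m) := by
      rw [← hgm]; group
    have h2 := congrArg (fun x : G d => (x : Matrix (Fin d) (Fin d) ℝ)) h1
    simpa only [Matrix.SpecialLinearGroup.coe_mul, hmε, expA_coe, Matrix.diagonal_mul_diagonal]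
      using h2

/-- Every diagonal element of `G` lies in `AM`. -/
lemma exists_eq_expA_mul_of_diagonal {c : G d} {x : Fin d → ℝ}
    (hc : (c : Matrix (Fin d) (Fin d) ℝ) = Matrix.diagonal x) :
    ∃ Y : cartan d, (∀ i, (Y : Fin d → ℝ) i = Real.log |x i|) ∧ ∃ m ∈ M d, c = expA Y * m := by
  have hdet : ∏ i, x i = 1 := by
    have := c.det_coe
    rwa [hc, Matrix.det_diagonal] at this
  have hx : ∀ i, x i ≠ 0 := by
    intro i h0
    rw [Finset.prod_eq_zero (Finset.mem_univ i) h0] at hdet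
    exact zero_ne_one hdet
  have hsum : ∑ i, Real.log |x i| = 0 := by
    rw [← Real.log_prod (fun i _ => abs_ne_zero.2 (hx i)), ← Finset.abs_prod, hdet]
    simp
  refine ⟨⟨fun i => Real.log |x i|, mem_cartan.2 hsum⟩, fun i => rfl,
    (expA ⟨fun i => Real.log |x i|, mem_cartan.2 hsum⟩)⁻¹ * c, ?_, by group⟩
  refine mem_M_of_diagonal (ε := fun i => |x i|⁻¹ * x i) ?_ ?_
  · intro i
    rw [abs_mul, abs_inv, abs_abs, inv_mul_cancel₀ (abs_ne_zero.2 (hx i))]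
  · rw [← expA_neg, Matrix.SpecialLinearGroup.coe_mul, hc, expA_coe,
      Matrix.diagonal_mul_diagonal]
    congr 1
    ext i
    change Real.exp (-Real.log |x i|) * x i = |x i|⁻¹ * x i
    rw [Real.exp_neg, Real.exp_log (abs_pos.2 (hx i))]

/-! ### The flat orbit is a single `A`-orbit -/

lemma orbitA_act (z : Space Γ) (Y : cartan d) : orbitA (act z Y) = orbitA z := by
  ext w
  constructor
  · rintro ⟨Z, rfl⟩
    exact ⟨Y + Z, act_add z Y Z⟩
  · rintro ⟨Z, rfl⟩
    refine ⟨-Y + Z, ?_⟩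
    rw [← act_add]
    congr 1
    abel

lemma proj_mul_mem_M (g : G d) {m : G d} (hm : m ∈ M d) : proj Γ (g * m) = proj Γ g :=
  ((proj_eq_iff _ _).2 ⟨1, Γ.one_mem, m, hm, by simp⟩).symm

lemma proj_toReal_mul (g : G d) {δ : Matrix.SpecialLinearGroup (Fin d) ℤ} (hδ : δ ∈ Γ) :
    proj Γ (toReal δ * g) = proj Γ g :=
  ((proj_eq_iff _ _).2 ⟨δ, hδ, 1, (M d).one_mem, by simp⟩).symm

/-- Since `|μ i| = |μ' i|` and these moduli are distinct, `g⁻¹ g'` intertwines `diag μ` and `diag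
μ'` only if it is diagonal. Hence it lies in `AM`. -/
lemma orbitA_eq_of_mem_frames {γ : Matrix.SpecialLinearGroup (Fin d) ℤ}
    (h : IsLoxodromic (toReal γ)) {g g' : G d} (hg : g ∈ frames γ) (hg' : g' ∈ frames γ) :
    orbitA (proj Γ g') = orbitA (proj Γ g) := by
  obtain ⟨μ, hμ, hgμ⟩ := exists_eigenvalues_of_mem_frames h hg
  obtain ⟨μ', hμ', hgμ'⟩ := exists_eigenvalues_of_mem_frames h hg'
  have hinv : ((g⁻¹ : G d) : Matrix (Fin d) (Fin d) ℝ) * (g : Matrix (Fin d) (Fin d) ℝ) = 1 := by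
    rw [← Matrix.SpecialLinearGroup.coe_mul, inv_mul_cancel, Matrix.SpecialLinearGroup.coe_one]
  have hinv' : (g : Matrix (Fin d) (Fin d) ℝ) * ((g⁻¹ : G d) : Matrix (Fin d) (Fin d) ℝ) = 1 := by
    rw [← Matrix.SpecialLinearGroup.coe_mul, mul_inv_cancel, Matrix.SpecialLinearGroup.coe_one]
  have hint : Matrix.diagonal μ * ((g⁻¹ * g' : G d) : Matrix (Fin d) (Fin d) ℝ) =
      ((g⁻¹ * g' : G d) : Matrix (Fin d) (Fin d) ℝ) * Matrix.diagonal μ' := by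
    rw [Matrix.SpecialLinearGroup.coe_mul, mul_assoc, ← hgμ', ← mul_assoc, ← mul_assoc]
    congr 1
    calc Matrix.diagonal μ * ((g⁻¹ : G d) : Matrix (Fin d) (Fin d) ℝ)
        = ((g⁻¹ : G d) : Matrix (Fin d) (Fin d) ℝ) *
            ((g : Matrix (Fin d) (Fin d) ℝ) * Matrix.diagonal μ) *
            ((g⁻¹ : G d) : Matrix (Fin d) (Fin d) ℝ) := by rw [← mul_assoc, hinv, one_mul]
      _ = _ := by rw [← hgμ, mul_assoc, mul_assoc, hinv', mul_one]
  have hdiag := eq_diagonal_of_intertwine (fun i j hij => by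
    have := hμ i
    rw [hij, hμ' j] at this
    exact (exp_openChamber_injective h _ _ this).symm) hint
  obtain ⟨Y, -, m, hm, hY⟩ := exists_eq_expA_mul_of_diagonal hdiag
  have hg'' : g' = g * expA Y * m := by rw [mul_assoc, ← hY]; group
  rw [hg'', proj_mul_mem_M _ hm, ← act_proj, orbitA_act]

lemma flatOrbit_eq {γ : Matrix.SpecialLinearGroup (Fin d) ℤ}
    (h : IsLoxodromic (toReal γ)) {g : G d} (hg : g ∈ frames γ) :
    flatOrbit Γ γ = orbitA (proj Γ g) := by
  apply Set.Subset.antisymm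
  · refine Set.iUnion₂_subset fun g' hg' => ?_
    rw [orbitA_eq_of_mem_frames h hg hg']
  · exact Set.subset_biUnion_of_mem (u := fun g => orbitA (proj Γ g)) hg

/-! ### Discreteness of the periods and compactness of periodic orbits -/

lemma continuous_expA : Continuous (expA : cartan d → G d) := by
  refine continuous_induced_rng.2 ?_
  refine Continuous.matrix_diagonal ?_
  exact continuous_pi fun i =>
    Real.continuous_exp.comp ((continuous_apply i).comp continuous_subtype_val)

lemma continuous_proj : Continuous (proj Γ : G d → Space Γ) := continuous_coinduced_rng

lemma continuous_act_proj (g : G d) : Continuous (act (proj Γ g)) :=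
  continuous_proj.comp (continuous_const.mul continuous_expA)

lemma mem_periods_orbitA {z : Space Γ} {Y : cartan d} :
    Y ∈ periods (orbitA z) ↔ act z Y = z := by
  constructor
  · intro h
    exact h z ⟨0, act_zero z⟩
  · rintro h _ ⟨Z, rfl⟩
    rw [← act_add, add_comm, act_add, h]

lemma expA_injective : Function.Injective (expA : cartan d → G d) := by
  intro Y Z h
  ext i
  have h1 := congrArg (fun x : G d => (x : Matrix (Fin d) (Fin d) ℝ) i i) h
  simpa [expA_coe] using h1

/-- A period gives `toReal δ = g e^Y m g⁻¹` with `m ∈ M`. As `m` commutes with `e^Y` and `m² = 1`,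
squaring removes it, whence the factor `2`. -/
lemma exists_toReal_of_act_eq {Y₀ : cartan d} (hY₀ : Y₀ ∈ openChamber d) {g : G d} {Y : cartan d}
    (h : act (proj Γ g) Y = proj Γ g) :
    ∃ δ ∈ Γ, g * expA (2 • Y) * g⁻¹ = toReal δ := by
  rw [act_proj, eq_comm, proj_eq_iff] at h
  obtain ⟨δ, hδ, m, hm, h1⟩ := h
  refine ⟨δ * δ, Γ.mul_mem hδ hδ, ?_⟩
  obtain ⟨ε, hε, hmε⟩ := exists_diagonal_of_mem_M hY₀ hm
  have hm2 : m * m = 1 := by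
    apply Subtype.ext
    rw [Matrix.SpecialLinearGroup.coe_mul, hmε, Matrix.diagonal_mul_diagonal,
      Matrix.SpecialLinearGroup.coe_one, ← Matrix.diagonal_one]
    congr 1
    ext i
    rw [← abs_mul_abs_self, hε i, one_mul]
  have hc : expA Y * m = m * expA Y := (Subgroup.mem_inf.1 hm).2 _ ⟨Y, rfl⟩
  have h2 : toReal δ = g * (expA Y * m) * g⁻¹ := by
    rw [← mul_assoc g, h1]
    simp only [mul_assoc, hm2]
    group
  rw [map_mul, h2, two_smul, expA_add]
  have : expA Y * expA Y = expA Y * m * (expA Y * m) := by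
    rw [mul_assoc, ← mul_assoc m, ← hc, mul_assoc, hm2, mul_one]
  rw [this]
  group

/-- For a period `Y`, the matrix `g e^{2Y} g⁻¹` is integral. When `Y` is near `0` its entries differ
from those of the identity by less than `1`, so it is the identity. -/
lemma discreteTopology_periods {Y₀ : cartan d} (hY₀ : Y₀ ∈ openChamber d) (g : G d) :
    DiscreteTopology (periods (orbitA (proj Γ g))) := by
  apply discreteTopology_of_isOpen_singleton_zero
  have hcont : Continuous fun Y : cartan d =>
      ((g * expA (2 • Y) * g⁻¹ : G d) : Matrix (Fin d) (Fin d) ℝ) :=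
    continuous_subtype_val.comp
      ((continuous_const.mul (continuous_expA.comp (continuous_const_smul 2))).mul
        continuous_const)
  have hopen : IsOpen {Y : cartan d | ∀ i j,
      |((g * expA (2 • Y) * g⁻¹ : G d) : Matrix (Fin d) (Fin d) ℝ) i j -
        (1 : Matrix (Fin d) (Fin d) ℝ) i j| < 1} := by
    simp only [Set.ofPred_forall]
    refine isOpen_iInter_of_finite fun i => isOpen_iInter_of_finite fun j => ?_
    refine isOpen_lt ?_ continuous_const
    exact ((hcont.matrix_elem i j).sub continuous_const).abs
  convert hopen.preimage (continuous_subtype_val : Continuous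
    (Subtype.val : periods (orbitA (proj Γ g)) → cartan d)) using 1
  ext ⟨Y, hY⟩
  simp only [Set.mem_singleton_iff, Set.mem_preimage, Set.mem_ofPred_eq]
  constructor
  · intro h
    have hY0 : Y = 0 := congrArg Subtype.val h
    intro i j
    simp [hY0, expA_zero]
  · intro h
    obtain ⟨δ, -, hδ⟩ := exists_toReal_of_act_eq hY₀ (mem_periods_orbitA.1 hY)
    have hδ1 : δ = 1 := by
      ext i j
      have h1 := h i j
      rw [hδ] at h1
      have h2 : ((toReal δ : G d) : Matrix (Fin d) (Fin d) ℝ) i j -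
          (1 : Matrix (Fin d) (Fin d) ℝ) i j = ((δ i j - (1 : Matrix (Fin d) (Fin d) ℤ) i j : ℤ) : ℝ) := by
        simp [Matrix.one_apply]
      rw [h2, ← Int.cast_abs] at h1
      have h3 : |δ i j - (1 : Matrix (Fin d) (Fin d) ℤ) i j| < 1 := by exact_mod_cast h1
      rw [Matrix.SpecialLinearGroup.coe_one]
      exact sub_eq_zero.1 (Int.abs_lt_one_iff.1 h3)
    rw [hδ1, map_one] at hδ
    have h1 : expA (2 • Y) = expA 0 := by
      rw [expA_zero]
      calc expA (2 • Y) = g⁻¹ * (g * expA (2 • Y) * g⁻¹) * g := by group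
        _ = 1 := by rw [hδ]; group
    have h2 := expA_injective h1
    have h3 : Y = 0 := by simpa using h2
    exact Subtype.ext h3

/-- A compact periodic `A`-orbit is compact. -/
lemma IsCompactPeriodic.isCompact {F : Set (Space Γ)} (hF : IsCompactPeriodic F) :
    IsCompact F := by
  obtain ⟨⟨z, rfl⟩, hdisc, hspan⟩ := hF
  obtain ⟨g, rfl⟩ := proj_surjective z
  -- The orbit map factors through the compact torus `𝔞 / L`.
  let L : Submodule ℤ (cartan d) := (periods (orbitA (proj Γ g))).toIntSubmodule
  have : DiscreteTopology L := hdisc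
  have : IsZLattice ℝ L := ⟨hspan⟩
  refine IsZLattice.isCompact_range_of_periodic L _ (continuous_act_proj g) fun z w hw => ?_
  rw [add_comm, act_add, mem_periods_orbitA.1 hw]

/-! ### Eigenframes and integral factors of the characteristic polynomial -/

/-- The columns of `g` are eigenvectors of `γ` for the eigenvalues `μ`. -/
def IsEigenframe (γ : Matrix.SpecialLinearGroup (Fin d) ℤ) (g : G d) (μ : Fin d → ℝ) : Prop :=
  (toReal γ : Matrix (Fin d) (Fin d) ℝ) * (g : Matrix (Fin d) (Fin d) ℝ) =
    (g : Matrix (Fin d) (Fin d) ℝ) * Matrix.diagonal μ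

/-- One frame diagonalizes all of `ℤ[γ]`. This shows `f(γ)` to be singular for a factor `f`, and
later turns units into elements of `Γ`. -/
lemma IsEigenframe.aeval {γ : Matrix.SpecialLinearGroup (Fin d) ℤ} {g : G d} {μ : Fin d → ℝ}
    (h : IsEigenframe γ g μ) (f : Polynomial ℤ) :
    (Polynomial.aeval (γ : Matrix (Fin d) (Fin d) ℤ) f).map (Int.castRingHom ℝ) *
        (g : Matrix (Fin d) (Fin d) ℝ) =
      (g : Matrix (Fin d) (Fin d) ℝ) * Matrix.diagonal fun i => Polynomial.aeval (μ i) f := by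
  induction f using Polynomial.induction_on with
  | C a =>
    ext i j
    rw [Matrix.mul_diagonal, Polynomial.aeval_C, Polynomial.aeval_C, Algebra.algebraMap_eq_smul_one]
    have : ((a • (1 : Matrix (Fin d) (Fin d) ℤ)).map (Int.castRingHom ℝ)) =
        (a : ℝ) • (1 : Matrix (Fin d) (Fin d) ℝ) := by
      ext k l
      rw [Matrix.map_apply, Matrix.smul_apply, Matrix.smul_apply]
      rcases eq_or_ne k l with rfl | hkl
      · simp
      · simp [hkl]
    rw [this, Matrix.smul_mul, one_mul, Matrix.smul_apply, smul_eq_mul, mul_comm]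
    simp
  | add p q hp hq =>
    simp only [map_add, ← Matrix.diagonal_add, mul_add, ← hp, ← hq]
    rw [Matrix.map_add _ (map_add _), add_mul]
  | monomial n a hn =>
    have h1 : ∀ q : Polynomial ℤ, (Polynomial.aeval (γ : Matrix (Fin d) (Fin d) ℤ)
        (q * Polynomial.X)) = (Polynomial.aeval (γ : Matrix (Fin d) (Fin d) ℤ) q) * γ :=
      fun q => by rw [map_mul, Polynomial.aeval_X]
    have h2 : (fun i => Polynomial.aeval (μ i) (Polynomial.C a * Polynomial.X ^ (n + 1))) =
        fun i => Polynomial.aeval (μ i) (Polynomial.C a * Polynomial.X ^ n) * μ i := by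
      ext i
      rw [pow_succ, ← mul_assoc, map_mul _ _ Polynomial.X, Polynomial.aeval_X]
    have h3 : (γ : Matrix (Fin d) (Fin d) ℤ).map (Int.castRingHom ℝ) *
        (g : Matrix (Fin d) (Fin d) ℝ) = (g : Matrix (Fin d) (Fin d) ℝ) * Matrix.diagonal μ := h
    rw [h2, pow_succ, ← mul_assoc, h1, Matrix.map_mul, mul_assoc, h3, ← mul_assoc, hn, mul_assoc,
      Matrix.diagonal_mul_diagonal]

lemma coe_mul_coe_inv (g : G d) :
    (g : Matrix (Fin d) (Fin d) ℝ) * ((g⁻¹ : G d) : Matrix (Fin d) (Fin d) ℝ) = 1 := by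
  rw [← Matrix.SpecialLinearGroup.coe_mul, mul_inv_cancel, Matrix.SpecialLinearGroup.coe_one]

lemma IsEigenframe.charpoly_map {γ : Matrix.SpecialLinearGroup (Fin d) ℤ} {g : G d}
    {μ : Fin d → ℝ} (h : IsEigenframe γ g μ) :
    (γ : Matrix (Fin d) (Fin d) ℤ).charpoly.map (Int.castRingHom ℝ) =
      ∏ i, (Polynomial.X - Polynomial.C (μ i)) := by
  rw [← Matrix.charpoly_diagonal, ← Matrix.charpoly_map]
  have h1 : (γ : Matrix (Fin d) (Fin d) ℤ).map (Int.castRingHom ℝ) =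
      (g : Matrix (Fin d) (Fin d) ℝ) *
        (Matrix.diagonal μ * ((g⁻¹ : G d) : Matrix (Fin d) (Fin d) ℝ)) := by
    rw [← mul_assoc, ← (show _ = _ from h), mul_assoc, coe_mul_coe_inv, mul_one]
    rfl
  rw [h1, Matrix.charpoly_mul_comm, mul_assoc, ← Matrix.SpecialLinearGroup.coe_mul,
    inv_mul_cancel, Matrix.SpecialLinearGroup.coe_one, mul_one]

/-- A monic integral divisor of the characteristic polynomial is the product of the linear factors
belonging to its roots. -/
lemma IsEigenframe.map_eq_prod {γ : Matrix.SpecialLinearGroup (Fin d) ℤ} {g : G d}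
    {μ : Fin d → ℝ} (h : IsEigenframe γ g μ) (hμ : Function.Injective μ) {f : Polynomial ℤ}
    (hf : f.Monic) (hdvd : f ∣ (γ : Matrix (Fin d) (Fin d) ℤ).charpoly) :
    ∃ I : Finset (Fin d), (∀ i, i ∈ I ↔ Polynomial.aeval (μ i) f = 0) ∧
      f.map (Int.castRingHom ℝ) = ∏ i ∈ I, (Polynomial.X - Polynomial.C (μ i)) := by
  classical
  set F := f.map (Int.castRingHom ℝ) with hF
  have hFm : F.Monic := hf.map _
  have hFd : F ∣ ∏ i, (Polynomial.X - Polynomial.C (μ i)) := by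
    rw [← h.charpoly_map]
    exact Polynomial.map_dvd _ hdvd
  have hp0 : ∏ i, (Polynomial.X - Polynomial.C (μ i)) ≠ 0 :=
    (Polynomial.monic_prod_of_monic _ _ fun i _ => Polynomial.monic_X_sub_C (μ i)).ne_zero
  have hsplit : F.Splits :=
    (Polynomial.Splits.prod fun i _ => Polynomial.Splits.X_sub_C (μ i)).of_dvd hp0 hFd
  have hroots : (∏ i, (Polynomial.X - Polynomial.C (μ i))).roots =
      (Finset.univ : Finset (Fin d)).val.map μ := by
    rw [Polynomial.roots_prod _ _ hp0]
    simp [Multiset.bind_singleton]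
  have hle := Polynomial.roots.le_of_dvd hp0 hFd
  rw [hroots] at hle
  have heval : ∀ x : ℝ, Polynomial.aeval x f = F.eval x := fun x => by
    rw [hF, Polynomial.eval_map, Polynomial.aeval_def]
    rfl
  refine ⟨Finset.univ.filter fun i => Polynomial.aeval (μ i) f = 0, by simp, ?_⟩
  -- The roots are simple because `μ` is injective, so `F` is determined by its set of roots.
  have hnd : F.roots.Nodup := Multiset.nodup_of_le hle (Finset.univ.nodup.map hμ)
  have hFr : F.roots =
      (Finset.univ.filter fun i => Polynomial.aeval (μ i) f = 0).val.map μ := by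
    refine (Multiset.Nodup.ext hnd ((Finset.nodup _).map hμ)).2 fun a => ?_
    rw [Polynomial.mem_roots hFm.ne_zero, Polynomial.IsRoot.def, Multiset.mem_map]
    constructor
    · intro ha
      have h1 := Multiset.mem_of_le hle ((Polynomial.mem_roots hFm.ne_zero).2 ha)
      obtain ⟨i, -, rfl⟩ := Multiset.mem_map.1 h1
      exact ⟨i, by simpa [heval] using ha, rfl⟩
    · rintro ⟨i, hi, rfl⟩
      simpa [heval] using hi
  rw [hsplit.eq_prod_roots_of_monic hFm, hFr, Multiset.map_map]
  rfl

/-- If no proper nonempty set of eigenvalues is the set of roots of a monic integral divisor of the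
characteristic polynomial, then this polynomial is irreducible over `ℚ`. -/
lemma IsEigenframe.irreducible (hd : 2 ≤ d) {γ : Matrix.SpecialLinearGroup (Fin d) ℤ} {g : G d}
    {μ : Fin d → ℝ} (h : IsEigenframe γ g μ) (hμ : Function.Injective μ)
    (H : ∀ (f : Polynomial ℤ) (I : Finset (Fin d)), f.Monic →
      f ∣ (γ : Matrix (Fin d) (Fin d) ℤ).charpoly → I.Nonempty → I ≠ Finset.univ →
      (∀ i, i ∈ I ↔ Polynomial.aeval (μ i) f = 0) →
      f.map (Int.castRingHom ℝ) = ∏ i ∈ I, (Polynomial.X - Polynomial.C (μ i)) → False) :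
    Irreducible ((γ : Matrix (Fin d) (Fin d) ℤ).charpoly.map (Int.castRingHom ℚ)) := by
  have hm := Matrix.charpoly_monic (γ : Matrix (Fin d) (Fin d) ℤ)
  have hdeg : (γ : Matrix (Fin d) (Fin d) ℤ).charpoly.natDegree = d := by
    rw [Matrix.charpoly_natDegree_eq_dim, Fintype.card_fin]
  -- By Gauss's lemma only monic integral factors need to be excluded.
  refine (hm.irreducible_iff_irreducible_map_fraction_map (K := ℚ)).1 ?_
  rw [hm.irreducible_iff_natDegree]
  refine ⟨?_, fun p q hp hq hpq => ?_⟩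
  · intro h1
    rw [h1, Polynomial.natDegree_one] at hdeg
    omega
  · by_contra! hne
    have hpd : p.natDegree + q.natDegree = d := by rw [← hp.natDegree_mul hq, hpq, hdeg]
    have hdvd : p ∣ (γ : Matrix (Fin d) (Fin d) ℤ).charpoly := ⟨q, hpq.symm⟩
    obtain ⟨I, hI, hprod⟩ := h.map_eq_prod hμ hp hdvd
    have hcard : p.natDegree = I.card := by
      rw [← hp.natDegree_map (Int.castRingHom ℝ), hprod, Polynomial.natDegree_prod_of_monic _ _
        fun i _ => Polynomial.monic_X_sub_C (μ i)]
      simp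
    refine H p I hp hdvd ?_ ?_ hI hprod
    · rw [← Finset.card_pos]
      omega
    · intro hu
      rw [hu, Finset.card_univ, Fintype.card_fin] at hcard
      omega

/-- Without a vanishing proper partial sum of the Jordan projection, the characteristic polynomial
is irreducible. -/
lemma irreducible_of_no_zero_sum (hd : 2 ≤ d) {γ : Matrix.SpecialLinearGroup (Fin d) ℤ} {g : G d}
    {μ t : Fin d → ℝ} (h : IsEigenframe γ g μ) (hμ : Function.Injective μ)
    (ht : ∀ i, |μ i| = Real.exp (t i))
    (H : ¬ ∃ I : Finset (Fin d), I.Nonempty ∧ I ≠ Finset.univ ∧ ∑ i ∈ I, t i = 0) :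
    Irreducible ((γ : Matrix (Fin d) (Fin d) ℤ).charpoly.map (Int.castRingHom ℚ)) := by
  refine h.irreducible hd hμ fun f I hf hdvd hne huniv hI hprod => H ⟨I, hne, huniv, ?_⟩
  obtain ⟨q, hq⟩ := hdvd
  -- `p_γ(0) = ±1` forces `f(0) = ±1`, while `|f(0)|` is the product of the `|μ i| = exp (t i)` over
  -- `I`.
  have h0 : IsUnit ((γ : Matrix (Fin d) (Fin d) ℤ).charpoly.eval 0) := by
    rw [Matrix.eval_charpoly, map_zero, zero_sub, Matrix.det_neg, γ.det_coe, mul_one]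
    exact (isUnit_one.neg).pow _
  rw [hq, Polynomial.eval_mul] at h0
  have h1 : |f.eval 0| = 1 := Int.isUnit_iff_abs_eq.1 (isUnit_of_mul_isUnit_left h0)
  have h2 : |(f.map (Int.castRingHom ℝ)).eval 0| = 1 := by
    have : (f.map (Int.castRingHom ℝ)).eval 0 = ((f.eval 0 : ℤ) : ℝ) := by
      simp
    rw [this, ← Int.cast_abs, h1, Int.cast_one]
  rw [hprod, Polynomial.eval_prod, Finset.abs_prod] at h2
  have h3 : ∏ i ∈ I, Real.exp (t i) = 1 := by
    rw [← h2]
    refine Finset.prod_congr rfl fun i _ => ?_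
    simp [ht i]
  rwa [← Real.exp_sum, Real.exp_eq_one_iff] at h3

/-! ### Compact orbits force irreducibility -/

lemma isOpen_image_proj {V : Set (G d)} (hV : IsOpen V) : IsOpen (proj Γ '' V) := by
  rw [isOpen_coinduced]
  have : proj Γ ⁻¹' (proj Γ '' V) =
      ⋃ γ ∈ Γ, ⋃ m ∈ M d, (fun h : G d => toReal γ * h * m) ⁻¹' V := by
    ext h
    simp only [Set.mem_preimage, Set.mem_image, Set.mem_iUnion, exists_prop]
    constructor
    · rintro ⟨x, hx, hxh⟩
      obtain ⟨γ, hγ, m, hm, rfl⟩ := (proj_eq_iff _ _).1 hxh.symm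
      exact ⟨γ, hγ, m, hm, hx⟩
    · rintro ⟨γ, hγ, m, hm, hx⟩
      exact ⟨_, hx, ((proj_eq_iff _ _).2 ⟨γ, hγ, m, hm, rfl⟩).symm⟩
  rw [this]
  exact isOpen_biUnion fun γ _ => isOpen_biUnion fun m _ =>
    hV.preimage ((continuous_const.mul continuous_id).mul continuous_const)

/-- The easy half of Mahler's criterion: over a compact subset of `Γ \ G / M`, nonzero lattice
vectors are not short. -/
lemma exists_bound_of_isCompact {Y₀ : cartan d} (hY₀ : Y₀ ∈ openChamber d) {S : Set (Space Γ)}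
    (hS : IsCompact S) :
    ∃ n : ℕ, ∀ h : G d, proj Γ h ∈ S → ∀ w : Fin d → ℤ, w ≠ 0 →
      1 ≤ n * ∑ i, |((fun i => (w i : ℝ)) ᵥ* (h : Matrix (Fin d) (Fin d) ℝ)) i| := by
  -- The `V n` are an increasing open exhaustion of `G`, so the image of one of them covers `S`.
  -- Bounded entries of `h⁻¹` keep `v = (v h) h⁻¹` from being large when `v h` is short.
  let V : ℕ → Set (G d) := fun n =>
    {h | ∀ i j, |((h⁻¹ : G d) : Matrix (Fin d) (Fin d) ℝ) i j| < n}
  have hV : ∀ n, IsOpen (V n) := by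
    intro n
    simp only [V, Set.ofPred_forall]
    refine isOpen_iInter_of_finite fun i => isOpen_iInter_of_finite fun j => ?_
    refine isOpen_lt ?_ continuous_const
    have hinv : Continuous fun h : G d => h⁻¹ := continuous_inv
    exact ((continuous_subtype_val.comp hinv).matrix_elem i j).abs
  have hcov : S ⊆ ⋃ n, proj Γ '' V n := by
    intro z _
    obtain ⟨h, rfl⟩ := proj_surjective z
    obtain ⟨n, hn⟩ := exists_nat_gt (∑ i, ∑ j, |((h⁻¹ : G d) : Matrix (Fin d) (Fin d) ℝ) i j|)
    refine Set.mem_iUnion.2 ⟨n, h, fun i j => lt_of_le_of_lt ?_ hn, rfl⟩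
    exact (Finset.single_le_sum (f := fun j => |((h⁻¹ : G d) : Matrix (Fin d) (Fin d) ℝ) i j|)
      (fun _ _ => abs_nonneg _) (Finset.mem_univ j)).trans
      (Finset.single_le_sum
        (f := fun i => ∑ j, |((h⁻¹ : G d) : Matrix (Fin d) (Fin d) ℝ) i j|)
        (fun _ _ => Finset.sum_nonneg fun _ _ => abs_nonneg _) (Finset.mem_univ i))
  have hmono : Monotone fun n => proj Γ '' V n := by
    intro a b hab
    refine Set.image_mono fun h hh i j => (hh i j).trans_le ?_
    exact_mod_cast hab
  obtain ⟨n, hn⟩ := hS.elim_directed_cover _ (fun n => isOpen_image_proj (hV n)) hcov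
    hmono.directed_le
  refine ⟨n, fun h hh w hw => ?_⟩
  obtain ⟨h', hh', heq⟩ := hn hh
  obtain ⟨δ, -, m, hm, rfl⟩ := (proj_eq_iff _ _).1 heq
  obtain ⟨ε, hε, hmε⟩ := exists_diagonal_of_mem_M hY₀ hm
  -- Passing to the representative `h'` replaces `w` by another nonzero integral vector, and `m`
  -- changes only signs of coordinates.
  set v : Fin d → ℤ := w ᵥ* (δ : Matrix (Fin d) (Fin d) ℤ) with hv
  have hv0 : v ≠ 0 := by
    intro h0
    apply hw
    have h1 := congrArg (fun x => x ᵥ* ((δ⁻¹ : Matrix.SpecialLinearGroup (Fin d) ℤ) :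
      Matrix (Fin d) (Fin d) ℤ)) h0
    rwa [hv, Matrix.zero_vecMul, Matrix.vecMul_vecMul, ← Matrix.SpecialLinearGroup.coe_mul,
      mul_inv_cancel, Matrix.SpecialLinearGroup.coe_one, Matrix.vecMul_one] at h1
  have hwv : (fun i => (w i : ℝ)) ᵥ* ((toReal δ : G d) : Matrix (Fin d) (Fin d) ℝ) =
      fun i => (v i : ℝ) := by
    ext i
    simp [hv, Matrix.vecMul, dotProduct]
  obtain ⟨j, hj⟩ := Function.ne_iff.1 hv0
  set u := (fun i => (v i : ℝ)) ᵥ* (h' : Matrix (Fin d) (Fin d) ℝ) with hu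
  have hsum : ∑ i, |((fun i => (w i : ℝ)) ᵥ*
      ((toReal δ * h' * m : G d) : Matrix (Fin d) (Fin d) ℝ)) i| = ∑ i, |u i| := by
    refine Finset.sum_congr rfl fun i _ => ?_
    rw [Matrix.SpecialLinearGroup.coe_mul, Matrix.SpecialLinearGroup.coe_mul, hmε,
      ← Matrix.vecMul_vecMul, ← Matrix.vecMul_vecMul, hwv, ← hu, Matrix.vecMul_diagonal, abs_mul,
      hε i, mul_one]
  rw [hsum]
  have hvu : (v j : ℝ) = ∑ i, u i * ((h'⁻¹ : G d) : Matrix (Fin d) (Fin d) ℝ) i j := by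
    have h1 : u ᵥ* ((h'⁻¹ : G d) : Matrix (Fin d) (Fin d) ℝ) = fun i => (v i : ℝ) := by
      rw [hu, Matrix.vecMul_vecMul, coe_mul_coe_inv, Matrix.vecMul_one]
    exact (congrFun h1 j).symm
  have hvj : (1 : ℝ) ≤ |(v j : ℝ)| := by
    exact_mod_cast Int.one_le_abs hj
  calc (1 : ℝ) ≤ |(v j : ℝ)| := hvj
    _ ≤ ∑ i, |u i * ((h'⁻¹ : G d) : Matrix (Fin d) (Fin d) ℝ) i j| := by
      rw [hvu]
      exact Finset.abs_sum_le_sum_abs _ _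
    _ ≤ ∑ i, n * |u i| := by
      refine Finset.sum_le_sum fun i _ => ?_
      rw [abs_mul, mul_comm]
      exact mul_le_mul_of_nonneg_right (hh' i j).le (abs_nonneg _)
    _ = n * ∑ i, |u i| := by rw [Finset.mul_sum]

/-- The element of `𝔞` with entries `-s` on `I` and a constant entry outside of `I`. -/
lemma exists_cartan_eq_neg {I : Finset (Fin d)} (hI : I ≠ Finset.univ) (s : ℝ) :
    ∃ Y : cartan d, ∀ i ∈ I, (Y : Fin d → ℝ) i = -s := by
  classical
  have hc : (Iᶜ.card : ℝ) ≠ 0 := by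
    rw [Nat.cast_ne_zero, Finset.card_ne_zero, Finset.nonempty_iff_ne_empty, Ne,
      Finset.compl_eq_empty_iff]
    exact hI
  refine ⟨⟨fun i => if i ∈ I then -s else I.card * s / Iᶜ.card, mem_cartan.2 ?_⟩,
    fun i hi => if_pos hi⟩
  rw [← Finset.sum_add_sum_compl I, Finset.sum_congr rfl fun i hi => if_pos hi,
    Finset.sum_congr rfl fun i hi => if_neg (Finset.mem_compl.1 hi)]
  rw [Finset.sum_const, Finset.sum_const, nsmul_eq_mul, nsmul_eq_mul]
  field_simp
  ring

/-- If `F_[γ]` is compact, then the characteristic polynomial of `γ` is irreducible. -/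
lemma irreducible_of_isCompact (hd : 2 ≤ d) {γ : Matrix.SpecialLinearGroup (Fin d) ℤ} {g : G d}
    {μ : Fin d → ℝ} (h : IsEigenframe γ g μ) (hμ : Function.Injective μ)
    {Y₀ : cartan d} (hY₀ : Y₀ ∈ openChamber d) (hc : IsCompact (orbitA (proj Γ g))) :
    Irreducible ((γ : Matrix (Fin d) (Fin d) ℤ).charpoly.map (Int.castRingHom ℚ)) := by
  refine h.irreducible hd hμ fun f I hf hdvd hne huniv hI hprod => ?_
  obtain ⟨n, hn⟩ := exists_bound_of_isCompact hY₀ hc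
  have hdet : (Polynomial.aeval (γ : Matrix (Fin d) (Fin d) ℤ) f).det = 0 := by
    have h1 := congrArg Matrix.det (h.aeval f)
    obtain ⟨i, hi⟩ := hne
    rw [Matrix.det_mul, Matrix.det_mul, g.det_coe, Matrix.det_diagonal,
      Finset.prod_eq_zero (Finset.mem_univ i) ((hI i).1 hi), mul_zero, mul_one] at h1
    have h2 := (Int.castRingHom ℝ).map_det (Polynomial.aeval (γ : Matrix (Fin d) (Fin d) ℤ) f)
    rw [RingHom.mapMatrix_apply, h1] at h2
    exact Int.cast_eq_zero.1 h2
  -- Singularity over `ℤ` yields an integral vector in the left kernel of `f(γ)`.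
  obtain ⟨w, hw, hwf⟩ := Matrix.exists_vecMul_eq_zero_iff.2 hdet
  set u := (fun i => (w i : ℝ)) ᵥ* (g : Matrix (Fin d) (Fin d) ℝ) with hu
  have hu0 : ∀ i, i ∉ I → u i = 0 := by
    intro i hi
    have h1 : u ᵥ* Matrix.diagonal (fun i => Polynomial.aeval (μ i) f) = 0 := by
      rw [hu, Matrix.vecMul_vecMul, ← h.aeval f, ← Matrix.vecMul_vecMul]
      have : (fun i => (w i : ℝ)) ᵥ*
          (Polynomial.aeval (γ : Matrix (Fin d) (Fin d) ℤ) f).map (Int.castRingHom ℝ) = 0 := by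
        ext j
        have := congrArg (Int.cast : ℤ → ℝ) (congrFun hwf j)
        simpa [Matrix.vecMul, dotProduct] using this
      rw [this, Matrix.zero_vecMul]
    have h2 := congrFun h1 i
    rw [Matrix.vecMul_diagonal] at h2
    exact (mul_eq_zero.1 h2).resolve_right fun h3 => hi ((hI i).2 h3)
  -- With `s = n * ∑ |u i|`, contracting the coordinates in `I` by `e^{-s}` turns the lower bound
  -- into `1 ≤ s e^{-s}`, against `s + 1 ≤ e^s`.
  obtain ⟨Y, hY⟩ := exists_cartan_eq_neg huniv (n * ∑ i, |u i|)
  have h1 := hn (g * expA Y) ⟨Y, rfl⟩ w hw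
  have h2 : ∀ i, |((fun i => (w i : ℝ)) ᵥ*
      ((g * expA Y : G d) : Matrix (Fin d) (Fin d) ℝ)) i| =
      |u i| * Real.exp (-(n * ∑ i, |u i|)) := by
    intro i
    rw [Matrix.SpecialLinearGroup.coe_mul, ← Matrix.vecMul_vecMul, ← hu, expA_coe,
      Matrix.vecMul_diagonal, abs_mul, Real.abs_exp]
    by_cases hi : i ∈ I
    · rw [hY i hi]
    · simp [hu0 i hi]
  rw [Finset.sum_congr rfl fun i _ => h2 i, ← Finset.sum_mul, ← mul_assoc, Real.exp_neg,
    ← div_eq_mul_inv, le_div_iff₀ (Real.exp_pos _), one_mul] at h1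
  linarith [Real.add_one_le_exp (n * ∑ i, |u i|)]

/-! ### Units of the totally real field give a full lattice of periods -/

open NumberField in
/-- Some common power of all units of a number field lies in the order generated by an integral
primitive element. -/
lemma exists_unit_pow_mem_order {K : Type*} [Field K] [NumberField K] (B : PowerBasis ℚ K)
    (hB : IsIntegral ℤ B.gen) :
    ∃ N : ℕ, 0 < N ∧ ∀ u : (𝓞 K)ˣ, ∃ q : Polynomial ℤ,
      Polynomial.aeval B.gen q = ((u : 𝓞 K) : K) ^ N := by
  have hD : IsIntegral ℤ (Algebra.discr ℚ B.basis) :=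
    Algebra.discr_isIntegral ℚ fun i => by
      rw [B.basis_eq_pow]
      exact hB.pow _
  obtain ⟨m, hm⟩ := IsIntegrallyClosed.isIntegral_iff.1 hD
  have hm0 : m ≠ 0 := by
    rintro rfl
    exact Algebra.discr_not_zero_of_basis ℚ B.basis (by simpa using hm.symm)
  have hI : Ideal.span {(m : 𝓞 K)} ≠ ⊥ := by
    rw [Ne, Ideal.span_singleton_eq_bot]
    exact_mod_cast hm0
  have hfin : Finite (𝓞 K ⧸ Ideal.span {(m : 𝓞 K)}) := Ideal.finiteQuotientOfFreeOfNeBot _ hI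
  -- `m` is the discriminant of the power basis, so `m 𝓞 K ⊆ ℤ[B.gen]`. With `N` the order of `(𝓞 K
  -- / m)ˣ`, `u ^ N - 1` lies in `m 𝓞 K`.
  refine ⟨Nat.card (𝓞 K ⧸ Ideal.span {(m : 𝓞 K)})ˣ, Nat.card_pos, fun u => ?_⟩
  set N := Nat.card (𝓞 K ⧸ Ideal.span {(m : 𝓞 K)})ˣ
  have h1 : Units.map (Ideal.Quotient.mk (Ideal.span {(m : 𝓞 K)})).toMonoidHom u ^ N = 1 :=
    pow_card_eq_one'
  have h2 : Ideal.Quotient.mk (Ideal.span {(m : 𝓞 K)}) ((u : 𝓞 K) ^ N) =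
      Ideal.Quotient.mk _ 1 := by
    have := congrArg Units.val h1
    simpa using this
  rw [Ideal.Quotient.eq, Ideal.mem_span_singleton] at h2
  obtain ⟨z, hz⟩ := h2
  have h3 : ((u : 𝓞 K) : K) ^ N - 1 = m * (z : K) := by
    have := congrArg (algebraMap (𝓞 K) K) hz
    simpa using this
  have h4 := Algebra.discr_mul_isIntegral_mem_adjoin (R := ℤ) ℚ hB z.isIntegral_coe
  rw [← hm, Algebra.smul_def, eq_intCast, map_intCast, ← h3] at h4
  have h5 : ((u : 𝓞 K) : K) ^ N ∈ Algebra.adjoin ℤ {B.gen} := by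
    have := add_mem h4 (one_mem (Algebra.adjoin ℤ {B.gen}))
    simpa using this
  rw [Algebra.adjoin_singleton_eq_range_aeval] at h5
  exact h5

open NumberField NumberField.InfinitePlace NumberField.Units
  NumberField.Units.dirichletUnitTheorem in
/-- Dirichlet's unit theorem for a totally real field: the logarithmic vectors of the units
span the hyperplane `𝔞`. -/
lemma eq_top_of_log_units_mem {K : Type*} [Field K] [NumberField K] {σ : Fin d → K →+* ℝ}
    (hσ : Function.Injective σ) (hall : ∀ φ : K →+* ℂ, ∃ i, φ = Complex.ofRealHom.comp (σ i))
    {V : Submodule ℝ (cartan d)}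
    (hV : ∀ u : (𝓞 K)ˣ, ∃ Y ∈ V, ∀ i, (Y : Fin d → ℝ) i = Real.log |σ i ((u : 𝓞 K) : K)|) :
    V = ⊤ := by
  choose e he using fun w : InfinitePlace K => hall w.embedding
  have hval : ∀ (w : InfinitePlace K) (x : K), w x = |σ (e w) x| := by
    intro w x
    rw [← norm_embedding_eq, he w]
    simp
  have hreal : ∀ w : InfinitePlace K, w.IsReal := by
    intro w
    rw [isReal_iff, he w]
    ext x
    simp [ComplexEmbedding.conjugate_coe_eq]
  have hsurj : ∀ j, ∃ w : InfinitePlace K, e w = j := by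
    intro j
    refine ⟨mk (Complex.ofRealHom.comp (σ j)), hσ ?_⟩
    have hr : ComplexEmbedding.IsReal (Complex.ofRealHom.comp (σ j)) := by
      ext x
      simp [ComplexEmbedding.conjugate_coe_eq]
    have h1 := he (mk (Complex.ofRealHom.comp (σ j)))
    rw [embedding_mk_eq_of_isReal hr] at h1
    ext x
    have h2 := congrArg (fun φ : K →+* ℂ => φ x) h1
    exact (Complex.ofReal_injective h2).symm
  let f : cartan d →ₗ[ℝ] logSpace K :=
    LinearMap.pi fun w => (LinearMap.proj (e w.1)).comp (cartan d).subtype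
  have hf : ∀ Y w, f Y w = (Y : Fin d → ℝ) (e w.1) := fun _ _ => rfl
  -- `logSpace K` omits the place `w₀`; the missing coordinate is recovered from trace zero.
  have hinj : Function.Injective f := by
    rw [← LinearMap.ker_eq_bot, LinearMap.ker_eq_bot']
    intro Y hY
    have h0 : ∀ j, j ≠ e w₀ → (Y : Fin d → ℝ) j = 0 := by
      intro j hj
      obtain ⟨w, rfl⟩ := hsurj j
      have hw : w ≠ w₀ := fun h => hj (by rw [h])
      exact congrFun hY ⟨w, hw⟩
    have h1 : (Y : Fin d → ℝ) (e w₀) = 0 := by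
      rw [← mem_cartan.1 Y.2]
      exact (Finset.sum_eq_single _ (fun j _ hj => h0 j hj) (by simp)).symm
    ext j
    by_cases hj : j = e w₀
    · rw [hj, h1]; rfl
    · rw [h0 j hj]; rfl
  -- Every place is real, hence of multiplicity one, so `f` sends the vector of `log |σ i u|` to the
  -- logarithmic embedding of `u`.
  have htop : V.map f = ⊤ := by
    rw [eq_top_iff, ← unitLattice_span_eq_top K, Submodule.span_le]
    rintro _ ⟨u, -, rfl⟩
    obtain ⟨Y, hY, hYu⟩ := hV u.toMul
    refine ⟨Y, hY, ?_⟩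
    ext w
    rw [hf, hYu, ← hval]
    have := logEmbedding_component u.toMul w
    rw [mult, if_pos (hreal w.1), Nat.cast_one, one_mul] at this
    exact this.symm
  rw [eq_top_iff]
  intro Y _
  obtain ⟨Z, hZ, hZY⟩ : f Y ∈ V.map f := htop ▸ Submodule.mem_top
  rwa [← hinj hZY]

-- For a unit `u` write `u ^ N = q(B.gen)`. Then `q(γ)` is invertible over `ℤ`, a power of `q(γ)²`
-- lies in `Γ`, and its logarithmic eigenvalues give a period that is a multiple of the logarithmic
-- vector of `u`.
open NumberField in
lemma span_periods_eq_top {K : Type*} [Field K] [NumberField K] (hΓ : Γ.FiniteIndex)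
    {γ : Matrix.SpecialLinearGroup (Fin d) ℤ} {g : G d} {μ : Fin d → ℝ} (h : IsEigenframe γ g μ)
    (hμ : Function.Injective μ) (B : PowerBasis ℚ K) (hB : IsIntegral ℤ B.gen)
    {σ : Fin d → K →+* ℝ} (hσ : ∀ i, σ i B.gen = μ i)
    (hall : ∀ φ : K →+* ℂ, ∃ i, φ = Complex.ofRealHom.comp (σ i)) :
    Submodule.span ℝ (periods (orbitA (proj Γ g)) : Set (cartan d)) = ⊤ := by
  refine eq_top_of_log_units_mem (K := K) (fun i j hij => hμ (by rw [← hσ, ← hσ, hij])) hall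
    fun u => ?_
  obtain ⟨N, hN, hq⟩ := exists_unit_pow_mem_order B hB
  have haeval : ∀ (v : (𝓞 K)ˣ) (q : Polynomial ℤ),
      Polynomial.aeval B.gen q = ((v : 𝓞 K) : K) ^ N →
      ∀ i, Polynomial.aeval (μ i) q = σ i ((v : 𝓞 K) : K) ^ N := by
    intro v q hvq i
    have := Polynomial.aeval_algHom_apply (σ i).toIntAlgHom B.gen q
    rw [hvq] at this
    simpa [hσ] using this
  have hdet : ∀ q : Polynomial ℤ,
      (((Polynomial.aeval (γ : Matrix (Fin d) (Fin d) ℤ) q).det : ℤ) : ℝ) =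
        ∏ i, Polynomial.aeval (μ i) q := by
    intro q
    have h1 := congrArg Matrix.det (h.aeval q)
    rw [Matrix.det_mul, Matrix.det_mul, g.det_coe, Matrix.det_diagonal, mul_one, one_mul] at h1
    rw [← h1]
    exact (Int.castRingHom ℝ).map_det _
  obtain ⟨q, hqu⟩ := hq u
  obtain ⟨r, hru⟩ := hq u⁻¹
  -- The polynomial `r` of `u⁻¹` provides the inverse determinant.
  have hunit : IsUnit (Polynomial.aeval (γ : Matrix (Fin d) (Fin d) ℤ) q).det := by
    refine IsUnit.of_mul_eq_one (Polynomial.aeval (γ : Matrix (Fin d) (Fin d) ℤ) r).det ?_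
    have : (((Polynomial.aeval (γ : Matrix (Fin d) (Fin d) ℤ) q).det : ℤ) : ℝ) *
        (((Polynomial.aeval (γ : Matrix (Fin d) (Fin d) ℤ) r).det : ℤ) : ℝ) = 1 := by
      rw [hdet, hdet, ← Finset.prod_mul_distrib]
      refine Finset.prod_eq_one fun i _ => ?_
      rw [haeval u q hqu, haeval u⁻¹ r hru, ← mul_pow, ← map_mul, ← map_mul, Units.mul_inv]
      simp
    exact_mod_cast this
  -- The determinant of `q(γ)` may be `-1`; squaring makes it `1`.
  let δ : Matrix.SpecialLinearGroup (Fin d) ℤ :=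
    ⟨Polynomial.aeval (γ : Matrix (Fin d) (Fin d) ℤ) (q ^ 2), by
      rw [map_pow, Matrix.det_pow]
      exact Int.isUnit_sq hunit⟩
  obtain ⟨n, hn, -, hδn⟩ := Subgroup.exists_pow_mem_of_index_ne_zero hΓ.index_ne_zero δ
  have hδ : ((δ ^ n : Matrix.SpecialLinearGroup (Fin d) ℤ) : Matrix (Fin d) (Fin d) ℤ) =
      Polynomial.aeval (γ : Matrix (Fin d) (Fin d) ℤ) (q ^ (2 * n)) := by
    rw [Matrix.SpecialLinearGroup.coe_pow, pow_mul, map_pow _ (q ^ 2)]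
  have hdiag : ((g⁻¹ * (toReal (δ ^ n) * g) : G d) : Matrix (Fin d) (Fin d) ℝ) =
      Matrix.diagonal fun i => Polynomial.aeval (μ i) (q ^ (2 * n)) := by
    have h1 : ((toReal (δ ^ n) : G d) : Matrix (Fin d) (Fin d) ℝ) =
        ((δ ^ n : Matrix.SpecialLinearGroup (Fin d) ℤ) : Matrix (Fin d) (Fin d) ℤ).map
          (Int.castRingHom ℝ) := rfl
    rw [Matrix.SpecialLinearGroup.coe_mul, Matrix.SpecialLinearGroup.coe_mul, h1, hδ, h.aeval,
      ← mul_assoc, ← Matrix.SpecialLinearGroup.coe_mul, inv_mul_cancel,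
      Matrix.SpecialLinearGroup.coe_one, one_mul]
  obtain ⟨Y, hY, m, hm, hYm⟩ := exists_eq_expA_mul_of_diagonal hdiag
  -- `g e^Y m = δ^n g` with `δ^n ∈ Γ` and `m ∈ M`, so both sides define the same point as `g`.
  have hper : Y ∈ periods (orbitA (proj Γ g)) := by
    rw [mem_periods_orbitA, act_proj, ← proj_mul_mem_M _ hm, mul_assoc, ← hYm,
      mul_inv_cancel_left, proj_toReal_mul _ hδn]
  have hk : ((N * (2 * n) : ℕ) : ℝ) ≠ 0 := by
    rw [Nat.cast_ne_zero]
    positivity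
  refine ⟨((N * (2 * n) : ℕ) : ℝ)⁻¹ • Y, Submodule.smul_mem _ _ (Submodule.subset_span hper),
    fun i => ?_⟩
  rw [Submodule.coe_smul, Pi.smul_apply, hY, map_pow, haeval u q hqu, ← pow_mul, abs_pow,
    Real.log_pow, smul_eq_mul, inv_mul_cancel_left₀ hk]

/-- If the characteristic polynomial of `γ` is irreducible, then the periods of `F_[γ]` span
`𝔞`. -/
lemma span_periods_eq_top_of_irreducible (hΓ : Γ.FiniteIndex)
    {γ : Matrix.SpecialLinearGroup (Fin d) ℤ} {g : G d} {μ : Fin d → ℝ} (h : IsEigenframe γ g μ)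
    (hμ : Function.Injective μ)
    (hirr : Irreducible ((γ : Matrix (Fin d) (Fin d) ℤ).charpoly.map (Int.castRingHom ℚ))) :
    Submodule.span ℝ (periods (orbitA (proj Γ g)) : Set (cartan d)) = ⊤ := by
  set p := (γ : Matrix (Fin d) (Fin d) ℤ).charpoly with hp
  have : Fact (Irreducible (p.map (Int.castRingHom ℚ))) := ⟨hirr⟩
  let B := AdjoinRoot.powerBasis hirr.ne_zero
  have hgen : B.gen = AdjoinRoot.root (p.map (Int.castRingHom ℚ)) :=
    AdjoinRoot.powerBasis_gen hirr.ne_zero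
  have : FiniteDimensional ℚ (AdjoinRoot (p.map (Int.castRingHom ℚ))) := B.finite
  have : CharZero (AdjoinRoot (p.map (Int.castRingHom ℚ))) :=
    charZero_of_injective_algebraMap
      (algebraMap ℚ (AdjoinRoot (p.map (Int.castRingHom ℚ)))).injective
  have : NumberField (AdjoinRoot (p.map (Int.castRingHom ℚ))) := ⟨⟩
  have hint : IsIntegral ℤ B.gen := by
    refine ⟨p, Matrix.charpoly_monic _, ?_⟩
    have h1 := AdjoinRoot.eval₂_root (p.map (Int.castRingHom ℚ))
    rw [Polynomial.eval₂_map] at h1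
    rw [hgen]
    exact (congrArg (fun f => Polynomial.eval₂ f _ p) (RingHom.ext_int _ _)).trans h1
  have hroot : ∀ i, (p.map (Int.castRingHom ℚ)).eval₂ (algebraMap ℚ ℝ) (μ i) = 0 := by
    intro i
    have h1 : (p.map (Int.castRingHom ℝ)).eval (μ i) = 0 := by
      rw [hp, h.charpoly_map, Polynomial.eval_prod]
      exact Finset.prod_eq_zero (Finset.mem_univ i) (by simp)
    rw [Polynomial.eval_map] at h1
    rw [Polynomial.eval₂_map]
    exact (congrArg (fun f => Polynomial.eval₂ f _ p) (RingHom.ext_int _ _)).trans h1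
  let σ : Fin d → AdjoinRoot (p.map (Int.castRingHom ℚ)) →+* ℝ := fun i =>
    AdjoinRoot.lift (algebraMap ℚ ℝ) (μ i) (hroot i)
  have hσ : ∀ i, σ i B.gen = μ i := fun i => by
    rw [hgen]
    exact AdjoinRoot.lift_root (hroot i)
  refine span_periods_eq_top hΓ h hμ B hint hσ fun φ => ?_
  -- A complex embedding sends the generator to a root of `p`, and these are the real numbers `μ i`;
  -- hence the field is totally real.
  have hφ : (p.map (Int.castRingHom ℂ)).eval (φ B.gen) = 0 := by
    have h1 := congrArg φ (AdjoinRoot.eval₂_root (p.map (Int.castRingHom ℚ)))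
    rw [Polynomial.hom_eval₂, Polynomial.eval₂_map, map_zero] at h1
    rw [Polynomial.eval_map, hgen]
    exact (congrArg (fun f => Polynomial.eval₂ f _ p) (RingHom.ext_int _ _)).trans h1
  have hpc : p.map (Int.castRingHom ℂ) =
      ∏ i, (Polynomial.X - Polynomial.C (μ i : ℂ)) := by
    have h1 := congrArg (Polynomial.map Complex.ofRealHom) h.charpoly_map
    rw [Polynomial.map_map, Polynomial.map_prod] at h1
    rw [hp]
    refine (congrArg (fun f => Polynomial.map f _) (RingHom.ext_int _ _)).trans (h1.trans ?_)
    simp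
  rw [hpc, Polynomial.eval_prod] at hφ
  obtain ⟨i, -, hi⟩ := Finset.prod_eq_zero_iff.1 hφ
  refine ⟨i, AdjoinRoot.ringHom_ext (RingHom.ext_rat _ _) ?_⟩
  rw [← hgen, RingHom.comp_apply, hσ]
  simpa [sub_eq_zero] using hi

end PeriodicTori

end

theorem lemma6 (d : ℕ) (hd : 2 ≤ d)
    (Γ : Subgroup (Matrix.SpecialLinearGroup (Fin d) ℤ)) (hΓ : Γ.FiniteIndex)
    (γ : Matrix.SpecialLinearGroup (Fin d) ℤ) (hγ : γ ∈ Γ)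
    (hlox : PeriodicTori.IsLoxodromic (PeriodicTori.toReal γ)) :
    (PeriodicTori.IsCompactPeriodic (PeriodicTori.flatOrbit Γ γ) ↔
        Irreducible ((γ : Matrix (Fin d) (Fin d) ℤ).charpoly.map (Int.castRingHom ℚ))) ∧
      (IsCompact (PeriodicTori.flatOrbit Γ γ) ↔
        Irreducible ((γ : Matrix (Fin d) (Fin d) ℤ).charpoly.map (Int.castRingHom ℚ))) ∧
      ((¬ ∃ I : Finset (Fin d), I.Nonempty ∧ I ≠ Finset.univ ∧
          ∑ i ∈ I, (PeriodicTori.jordanProjection (PeriodicTori.toReal γ) : Fin d → ℝ) i = 0) →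
        Irreducible ((γ : Matrix (Fin d) (Fin d) ℤ).charpoly.map (Int.castRingHom ℚ))) := by
  open PeriodicTori in
  obtain ⟨g, hg⟩ := frames_nonempty hd hlox
  obtain ⟨μ, hμexp, hframe⟩ := exists_eigenvalues_of_mem_frames hlox hg
  have h : IsEigenframe γ g μ := hframe
  have hμ : Function.Injective μ := fun i j hij =>
    exp_openChamber_injective hlox i j (by rw [← hμexp, ← hμexp, hij])
  rw [flatOrbit_eq hlox hg]
  have hcompact : IsCompact (orbitA (proj Γ g)) →
      Irreducible ((γ : Matrix (Fin d) (Fin d) ℤ).charpoly.map (Int.castRingHom ℚ)) :=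
    irreducible_of_isCompact hd h hμ hlox
  have hperiodic :
      Irreducible ((γ : Matrix (Fin d) (Fin d) ℤ).charpoly.map (Int.castRingHom ℚ)) →
      IsCompactPeriodic (orbitA (proj Γ g)) := fun hirr =>
    ⟨⟨_, rfl⟩, discreteTopology_periods hlox g, span_periods_eq_top_of_irreducible hΓ h hμ hirr⟩
  exact ⟨⟨fun hF => hcompact hF.isCompact, hperiodic⟩,
    ⟨hcompact, fun hirr => (hperiodic hirr).isCompact⟩,
    irreducible_of_no_zero_sum hd h hμ hμexp⟩
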